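/- Let $N\ge 0$ be an integer and let $a>-1$, $\theta>0$ be real. Define the partition function of the $\theta$-deformed Bures ensemble with Laguerre weight by $$Z_N^B(a;\theta)=\frac{1}{N!}\int_{\mathbb{R}_+^N}\prod_{1\le j<k\le N}\frac{x_k-x_j}{x_k+x_j}\,(x_k^\theta-x_j^\theta)\prod_{j=1}^N x_j^a e^{-x_j}\,dx_1\cdots dx_N .$$ Then the integral converges absolutely and, with $\hat\beta=\frac{a+1}{\theta}-1$, $$Z_N^B(a;\theta)=\frac{\pi^{N/2}}{\theta^{N/2}\,2^{\theta N^2+2aN-(\theta-1)N}}\prod_{j=0}^{N-1}\left(\frac{\Gamma(j+1)\,\Gamma(2\hat\beta+j+2)}{\Gamma(\theta(j+\hat\beta+1)+\tfrac12)}\sqrt{\frac{\Gamma(2\theta(\hat\beta+j+1))\,\Gamma(2\theta(\hat\beta+j+1)+1)}{\Gamma(2(\hat\beta+j+1))\,\Gamma(2(\hat\beta+j+1)+1)}}\right).$$ -/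

import Mathlib

open MeasureTheory

noncomputable section

/-- The (unnormalised) density of the `θ`-deformed Bures ensemble with Laguerre weight,
`∏_{j<k} (x_k - x_j)/(x_k + x_j) (x_k^θ - x_j^θ) ∏_j x_j^a e^{-x_j}`. -/
def buresDensity (N : ℕ) (a θ : ℝ) (x : Fin N → ℝ) : ℝ :=
  (∏ j : Fin N, ∏ k ∈ Finset.Ioi j,
      ((x k - x j) / (x k + x j)) * (x k ^ θ - x j ^ θ)) *
    ∏ j : Fin N, (x j ^ a * Real.exp (-x j))

/-- The domain of integration `ℝ₊^N`. -/
def positiveOrthant (N : ℕ) : Set (Fin N → ℝ) := {x | ∀ j, 0 < x j}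

/-- The partition function `Z_N^B(a;θ)` of the `θ`-deformed Bures ensemble. -/
def buresPartition (N : ℕ) (a θ : ℝ) : ℝ :=
  (1 / (N.factorial : ℝ)) * ∫ x in positiveOrthant N, buresDensity N a θ x

end

/-! The `θ`-Vandermonde factor is a determinant. Its Leibniz expansion turns the integral into a
signed sum over permutations `σ` of means of the Schur product at independent gamma variables of
shapes `p (σ i)`, where `p i = a + 1 + θ i`, up to the normalisations `Γ (p i)`.

The key fact is `integral_schurProd`: for distinct shapes this mean is the Schur product of the
shapes themselves. For two variables, `X/(X+Y)` has mean `p/(p+q)`. In general, the Schur product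
satisfies Pfaffian-type expansions, even and odd, whose terms are a factor in two variables times a
Schur product in the others, or just a smaller Schur product. Independence and induction turn the
expansion at the variables into the same expansion at the shapes.

Permuting the shapes multiplies the Schur product by `sign σ`, which cancels the Leibniz sign. The
`N!` terms are therefore equal and absorb `1/N!` (`buresPartition_eq_schurProd`). For the arithmetic
progression `p` the remaining product is a ratio of gamma values, and the duplication formula gives
the stated form. -/

/-- The product `∏_{j<k} (x_k - x_j)/(x_k + x_j)` over pairs of indices in a finite set, which
equals the Schur Pfaffian when the set has even cardinality. -/
noncomputable def schurProd {ι : Type*} [LinearOrder ι] (s : Finset ι) (x : ι → ℝ) : ℝ :=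
  ∏ j ∈ s, ∏ k ∈ s with j < k, (x k - x j) / (x k + x j)

/-- The sign picked up when the factors of `schurProd s` containing the index `k` are oriented
away from `k`. -/
def eraseSign {ι : Type*} [LinearOrder ι] (s : Finset ι) (k : ι) : ℝ :=
  ∏ j ∈ s.erase k, if k < j then 1 else -1

/-! ### Pfaffian-type expansions of the Schur product. -/

section Algebra

variable {ι : Type*} [LinearOrder ι]

lemma schurProd_eq_erase (s : Finset ι) (x : ι → ℝ) {k : ι} (hk : k ∈ s) :
    schurProd s x = eraseSign s k * (∏ j ∈ s.erase k, (x j - x k) / (x j + x k)) *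
      schurProd (s.erase k) x := by
  have h1 : ∀ j ∈ s.erase k, ∏ i ∈ s with j < i, (x i - x j) / (x i + x j) =
      (if j < k then (x k - x j) / (x k + x j) else 1) *
        ∏ i ∈ s.erase k with j < i, (x i - x j) / (x i + x j) := by
    intro j _
    rw [Finset.prod_filter, Finset.prod_filter, ← Finset.mul_prod_erase s _ hk]
  have h2 : ∏ i ∈ s with k < i, (x i - x k) / (x i + x k) =
      ∏ i ∈ s.erase k, if k < i then (x i - x k) / (x i + x k) else 1 := by
    rw [Finset.prod_filter, ← Finset.mul_prod_erase s _ hk]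
    simp
  have h3 : (∏ i ∈ s.erase k, if k < i then (x i - x k) / (x i + x k) else 1) *
      (∏ j ∈ s.erase k, if j < k then (x k - x j) / (x k + x j) else 1) =
      eraseSign s k * ∏ j ∈ s.erase k, (x j - x k) / (x j + x k) := by
    rw [eraseSign, ← Finset.prod_mul_distrib, ← Finset.prod_mul_distrib]
    refine Finset.prod_congr rfl fun j hj => ?_
    rcases lt_or_gt_of_ne (Finset.ne_of_mem_erase hj) with h | h
    · rw [if_neg h.asymm, if_pos h, if_neg h.asymm, add_comm (x k)]
      ring
    · rw [if_pos h, if_neg h.asymm, if_pos h]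
      ring
  rw [← h3, schurProd, ← Finset.mul_prod_erase s
    (fun j => ∏ i ∈ s with j < i, (x i - x j) / (x i + x j)) hk, h2, Finset.prod_congr rfl h1,
    Finset.prod_mul_distrib, ← mul_assoc, schurProd]

-- Lagrange interpolation at the nodes `x k`, evaluated at `-z`, for the difference `∏ (X + x j) - ∏
-- (X - x j)`: the leading terms cancel, so the degree is below the number of nodes, and the second
-- product vanishes at each node.
open Polynomial in
lemma sum_two_mul_div_add_mul_prod (t : Finset ι) (ht : Odd t.card) {x : ι → ℝ}
    (hx : ∀ i ∈ t, 0 < x i) (hinj : Set.InjOn x t) {z : ℝ} (hz : 0 ≤ z) :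
    ∑ k ∈ t, 2 * x k / (x k + z) * ∏ j ∈ t.erase k, (x j + x k) / (x j - x k) =
      1 + ∏ j ∈ t, (x j - z) / (x j + z) := by
  set g : ℝ[X] := ∏ j ∈ t, (X + C (x j)) - ∏ j ∈ t, (X - C (x j)) with hg
  have hm1 : (∏ j ∈ t, (X + C (x j))).Monic := monic_prod_of_monic _ _ fun i _ => monic_X_add_C _
  have hm2 : (∏ j ∈ t, (X - C (x j))).Monic := monic_prod_of_monic _ _ fun i _ => monic_X_sub_C _
  have hd1 : (∏ j ∈ t, (X + C (x j))).degree = (t.card : WithBot ℕ) := by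
    rw [degree_prod]; simp
  have hd2 : (∏ j ∈ t, (X - C (x j))).degree = (t.card : WithBot ℕ) := by
    rw [degree_prod]; simp
  have hdeg : g.degree < t.card := by
    rw [← hd1]
    exact degree_sub_lt_left (hd1.trans hd2.symm) hm1.ne_zero
      (by rw [hm1.leadingCoeff, hm2.leadingCoeff])
  have hL := congrArg (eval (-z)) (Lagrange.eq_interpolate hinj hdeg)
  have hpos : ∀ j ∈ t, x j + z ≠ 0 := fun j hj => by have := hx j hj; positivity
  have hP : ∏ j ∈ t, (x j + z) ≠ 0 := Finset.prod_ne_zero_iff.2 hpos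
  have hgz : eval (-z) g = ∏ j ∈ t, (x j - z) + ∏ j ∈ t, (x j + z) := by
    -- Odd cardinality enters here, through the sign of the second product at `-z`.
    have : ∏ j ∈ t, (-z - x j) = - ∏ j ∈ t, (x j + z) := by
      rw [← neg_one_mul (∏ j ∈ t, (x j + z)), ← ht.neg_one_pow, ← Finset.prod_const,
        ← Finset.prod_mul_distrib]
      exact Finset.prod_congr rfl fun _ _ => by ring
    simp only [hg, eval_sub, eval_prod, eval_add, eval_X, eval_C, this, sub_neg_eq_add]
    congr 1
    exact Finset.prod_congr rfl fun _ _ => by ring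
  rw [hgz, Lagrange.interpolate_apply, eval_finsetSum] at hL
  have hk : ∀ k ∈ t, eval (-z) (C (eval (x k) g) * Lagrange.basis t x k) =
      (2 * x k / (x k + z) * ∏ j ∈ t.erase k, (x j + x k) / (x j - x k)) *
        ∏ j ∈ t, (x j + z) := by
    intro k hk
    have e1 : eval (x k) g = 2 * x k * ∏ j ∈ t.erase k, (x j + x k) := by
      simp only [hg, eval_sub, eval_prod, eval_add, eval_X, eval_C]
      rw [Finset.prod_eq_zero (f := fun j => x k - x j) hk (sub_self _), sub_zero,
        ← Finset.mul_prod_erase t _ hk]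
      simp only [add_comm (x k), two_mul]
    have e2 : eval (-z) (Lagrange.basis t x k) =
        ∏ j ∈ t.erase k, (x j + z) / (x j - x k) := by
      rw [Lagrange.basis, eval_prod]
      refine Finset.prod_congr rfl fun j hj => ?_
      have hne : x j - x k ≠ 0 := sub_ne_zero.2 fun h =>
        Finset.ne_of_mem_erase hj (hinj (Finset.mem_of_mem_erase hj) hk h)
      have hne' : x k - x j ≠ 0 := sub_ne_zero.2 (sub_ne_zero.1 hne).symm
      simp only [Lagrange.basisDivisor, eval_mul, eval_C, eval_sub, eval_X]
      field_simp
      ring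
    rw [eval_mul, eval_C, e1, e2, ← Finset.mul_prod_erase t (fun j => x j + z) hk]
    simp only [Finset.prod_div_distrib]
    have := hpos k hk
    field_simp
  rw [Finset.sum_congr rfl hk, ← Finset.sum_mul] at hL
  rw [Finset.prod_div_distrib, eq_comm, ← mul_left_inj' hP, ← hL]
  field_simp
  ring

/-- Since `2x/(x+z) = 1 + (x-z)/(x+z)`, the identity at `z` minus half the identity at `0` removes
the constant 1. -/
lemma prod_sub_div_add_eq_sum (t : Finset ι) (ht : Odd t.card) {x : ι → ℝ}
    (hx : ∀ i ∈ t, 0 < x i) (hinj : Set.InjOn x t) {z : ℝ} (hz : 0 ≤ z) :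
    ∏ j ∈ t, (x j - z) / (x j + z) =
      ∑ k ∈ t, (x k - z) / (x k + z) * ∏ j ∈ t.erase k, (x j + x k) / (x j - x k) := by
  have h0 := sum_two_mul_div_add_mul_prod t ht hx hinj le_rfl
  have hz' := sum_two_mul_div_add_mul_prod t ht hx hinj hz
  have e0 : ∏ j ∈ t, (x j - 0) / (x j + 0) = 1 :=
    Finset.prod_eq_one fun j hj => by have := (hx j hj).ne'; simp [this]
  have s0 : ∑ k ∈ t, 2 * x k / (x k + 0) * ∏ j ∈ t.erase k, (x j + x k) / (x j - x k) =
      2 * ∑ k ∈ t, ∏ j ∈ t.erase k, (x j + x k) / (x j - x k) := by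
    rw [Finset.mul_sum]
    refine Finset.sum_congr rfl fun k hk => ?_
    have := (hx k hk).ne'
    rw [add_zero, mul_div_cancel_right₀ _ this]
  rw [s0, e0] at h0
  have sz : ∑ k ∈ t, 2 * x k / (x k + z) * ∏ j ∈ t.erase k, (x j + x k) / (x j - x k) =
      ∑ k ∈ t, (x k - z) / (x k + z) * ∏ j ∈ t.erase k, (x j + x k) / (x j - x k) +
        ∑ k ∈ t, ∏ j ∈ t.erase k, (x j + x k) / (x j - x k) := by
    rw [← Finset.sum_add_distrib]
    refine Finset.sum_congr rfl fun k hk => ?_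
    have : x k + z ≠ 0 := by have := hx k hk; positivity
    field_simp
    ring
  rw [sz] at hz'
  linarith

/-- Source of both expansions: `z = 0` gives the odd one, and `z` equal to a further variable gives
the even one. -/
lemma schurProd_mul_prod_eq_sum (t : Finset ι) (ht : Odd t.card) {x : ι → ℝ}
    (hx : ∀ i ∈ t, 0 < x i) (hinj : Set.InjOn x t) {z : ℝ} (hz : 0 ≤ z) :
    (∏ j ∈ t, (x j - z) / (x j + z)) * schurProd t x =
      ∑ k ∈ t, eraseSign t k * ((x k - z) / (x k + z) * schurProd (t.erase k) x) := by
  rw [prod_sub_div_add_eq_sum t ht hx hinj hz, Finset.sum_mul]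
  refine Finset.sum_congr rfl fun k hk => ?_
  have hcancel : (∏ j ∈ t.erase k, (x j + x k) / (x j - x k)) *
      ∏ j ∈ t.erase k, (x j - x k) / (x j + x k) = 1 := by
    rw [← Finset.prod_mul_distrib]
    refine Finset.prod_eq_one fun j hj => ?_
    have h1 : x j - x k ≠ 0 := sub_ne_zero.2 fun h =>
      Finset.ne_of_mem_erase hj (hinj (Finset.mem_of_mem_erase hj) hk h)
    have h2 : x j + x k ≠ 0 := by
      have := hx k hk; have := hx j (Finset.mem_of_mem_erase hj); positivity
    field_simp
  rw [schurProd_eq_erase t x hk]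
  linear_combination (eraseSign t k * ((x k - z) / (x k + z)) * schurProd (t.erase k) x) * hcancel

/-- Expansion of `schurProd` over a set of odd cardinality. -/
lemma schurProd_eq_sum_of_odd (t : Finset ι) (ht : Odd t.card) {x : ι → ℝ}
    (hx : ∀ i ∈ t, 0 < x i) (hinj : Set.InjOn x t) :
    schurProd t x = ∑ k ∈ t, eraseSign t k * schurProd (t.erase k) x := by
  have h := schurProd_mul_prod_eq_sum t ht hx hinj le_rfl
  have e : ∀ k ∈ t, (x k - 0) / (x k + 0) = 1 := fun k hk => by
    have := (hx k hk).ne'; simp [this]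
  rw [Finset.prod_eq_one e, one_mul] at h
  rw [h]
  exact Finset.sum_congr rfl fun k hk => by rw [e k hk, one_mul]

/-- Expansion of `schurProd` over a set of even cardinality along one of its elements. -/
lemma schurProd_eq_sum_of_even (s : Finset ι) {m : ι} (hm : m ∈ s) (hs : Odd (s.erase m).card)
    {x : ι → ℝ} (hx : ∀ i ∈ s, 0 < x i) (hinj : Set.InjOn x s) :
    schurProd s x = eraseSign s m * ∑ k ∈ s.erase m, eraseSign (s.erase m) k *
      ((x k - x m) / (x k + x m) * schurProd ((s.erase m).erase k) x) := by
  rw [schurProd_eq_erase s x hm, mul_assoc, schurProd_mul_prod_eq_sum (s.erase m) hs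
    (fun i hi => hx i (Finset.mem_of_mem_erase hi))
    (hinj.mono (Finset.coe_subset.2 (Finset.erase_subset _ _))) (hx m hm).le]

end Algebra

/-! ### The mean of `(Y - X)/(Y + X)` for two gamma variables. -/

section Gamma

open ProbabilityTheory

lemma lintegral_gammaMeasure {p : ℝ} {f : ℝ → ENNReal} (hf : Measurable f) :
    ∫⁻ x, f x ∂gammaMeasure p 1 =
      ∫⁻ x in Set.Ioi 0, ENNReal.ofReal (1 / Real.Gamma p * (x ^ (p - 1) * Real.exp (-x))) * f x := by
  have hm : Measurable (gammaPDF p 1) := (measurable_gammaPDFReal p 1).ennreal_ofReal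
  rw [gammaMeasure, lintegral_withDensity_eq_lintegral_mul _ hm hf, ← lintegral_add_compl _
    (measurableSet_Ici (a := (0 : ℝ))), Set.compl_Ici,
    setLIntegral_congr_fun (g := fun _ => 0) measurableSet_Iio, lintegral_zero, add_zero,
    setLIntegral_congr Ioi_ae_eq_Ici.symm]
  · refine setLIntegral_congr_fun measurableSet_Ioi fun x hx => ?_
    simp [Pi.mul_apply, gammaPDF_of_nonneg (le_of_lt (Set.mem_Ioi.1 hx)), mul_assoc]
  · intro x hx
    simp [Pi.mul_apply, gammaPDF_of_neg (Set.mem_Iio.1 hx)]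

lemma ae_pos_gammaMeasure (p : ℝ) : ∀ᵐ x ∂gammaMeasure p 1, 0 < x := by
  have hs : MeasurableSet {x : ℝ | ¬ 0 < x} := (measurableSet_lt measurable_const measurable_id).compl
  rw [ae_iff, ← lintegral_indicator_one hs, lintegral_gammaMeasure (measurable_one.indicator hs),
    setLIntegral_congr_fun (g := fun _ => 0) measurableSet_Ioi, lintegral_zero]
  intro x hx
  simp [Set.mem_Ioi.1 hx]

lemma lintegral_rpow_mul_exp_neg_mul_Ioi {r c : ℝ} (hr : 0 < r) (hc : 0 < c) :
    ∫⁻ x in Set.Ioi (0 : ℝ), ENNReal.ofReal (x ^ (r - 1) * Real.exp (-(c * x))) =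
      ENNReal.ofReal ((1 / c) ^ r * Real.Gamma r) := by
  have h := Real.integral_rpow_mul_exp_neg_mul_Ioi hr hc
  rw [← h, ofReal_integral_eq_lintegral_ofReal]
  · refine Integrable.of_integral_ne_zero ?_
    rw [h]
    positivity
  · refine (ae_restrict_iff' measurableSet_Ioi).2 (ae_of_all _ fun x hx => ?_)
    have : 0 < x := hx
    simp only [Pi.zero_apply]
    positivity

lemma lintegral_exp_neg_mul_gammaMeasure {p t : ℝ} (hp : 0 < p) (ht : 0 < t) :
    ∫⁻ x, ENNReal.ofReal (Real.exp (-(t * x))) ∂gammaMeasure p 1 =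
      ENNReal.ofReal ((1 + t) ^ (-p)) := by
  have hG : 0 < Real.Gamma p := Real.Gamma_pos_of_pos hp
  rw [lintegral_gammaMeasure (by fun_prop)]
  have : ∀ x ∈ Set.Ioi (0 : ℝ), ENNReal.ofReal (1 / Real.Gamma p * (x ^ (p - 1) * Real.exp (-x))) *
      ENNReal.ofReal (Real.exp (-(t * x))) = ENNReal.ofReal (1 / Real.Gamma p) *
        ENNReal.ofReal (x ^ (p - 1) * Real.exp (-((1 + t) * x))) := by
    intro x hx
    have : (0 : ℝ) < x := hx
    rw [← ENNReal.ofReal_mul (by positivity), ← ENNReal.ofReal_mul (by positivity),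
      show -((1 + t) * x) = -x + -(t * x) by ring, Real.exp_add]
    congr 1
    ring
  rw [setLIntegral_congr_fun measurableSet_Ioi this, lintegral_const_mul' _ _ ENNReal.ofReal_ne_top,
    lintegral_rpow_mul_exp_neg_mul_Ioi hp (by linarith), ← ENNReal.ofReal_mul (by positivity)]
  congr 1
  rw [one_div (1 + t), Real.inv_rpow (by linarith), Real.rpow_neg (by linarith)]
  field_simp

lemma lintegral_mul_exp_neg_mul_gammaMeasure {p t : ℝ} (hp : 0 < p) (ht : 0 < t) :
    ∫⁻ x, ENNReal.ofReal (x * Real.exp (-(t * x))) ∂gammaMeasure p 1 =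
      ENNReal.ofReal (p * (1 + t) ^ (-(p + 1))) := by
  have hG : 0 < Real.Gamma p := Real.Gamma_pos_of_pos hp
  rw [lintegral_gammaMeasure (by fun_prop)]
  have : ∀ x ∈ Set.Ioi (0 : ℝ), ENNReal.ofReal (1 / Real.Gamma p * (x ^ (p - 1) * Real.exp (-x))) *
      ENNReal.ofReal (x * Real.exp (-(t * x))) = ENNReal.ofReal (1 / Real.Gamma p) *
        ENNReal.ofReal (x ^ (p + 1 - 1) * Real.exp (-((1 + t) * x))) := by
    intro x hx
    have hx' : (0 : ℝ) < x := hx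
    rw [← ENNReal.ofReal_mul (by positivity), ← ENNReal.ofReal_mul (by positivity),
      show -((1 + t) * x) = -x + -(t * x) by ring, Real.exp_add,
      show p + 1 - 1 = (p - 1) + 1 by ring, Real.rpow_add_one hx'.ne']
    congr 1
    ring
  rw [setLIntegral_congr_fun measurableSet_Ioi this, lintegral_const_mul' _ _ ENNReal.ofReal_ne_top,
    lintegral_rpow_mul_exp_neg_mul_Ioi (by linarith) (by linarith),
    ← ENNReal.ofReal_mul (by positivity)]
  congr 1
  rw [one_div (1 + t), Real.inv_rpow (by linarith), Real.rpow_neg (by linarith),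
    Real.Gamma_add_one hp.ne']
  field_simp

lemma lintegral_exp_neg_mul_Ioi {c : ℝ} (hc : 0 < c) :
    ∫⁻ t in Set.Ioi (0 : ℝ), ENNReal.ofReal (Real.exp (-(c * t))) = ENNReal.ofReal (1 / c) := by
  simpa using lintegral_rpow_mul_exp_neg_mul_Ioi one_pos hc

lemma lintegral_one_add_rpow_neg {r : ℝ} (hr : 0 < r) :
    ∫⁻ t in Set.Ioi (0 : ℝ), ENNReal.ofReal ((1 + t) ^ (-(r + 1))) = ENNReal.ofReal (1 / r) := by
  have h := integral_Ioi_rpow_of_lt (a := -(r + 1)) (by linarith) one_pos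
  have h' := integrableOn_Ioi_rpow_of_lt (a := -(r + 1)) (by linarith) one_pos
  have e : ∫⁻ t in Set.Ioi (1 : ℝ), ENNReal.ofReal (t ^ (-(r + 1))) = ENNReal.ofReal (1 / r) := by
    rw [← ofReal_integral_eq_lintegral_ofReal h', h]
    · rw [Real.one_rpow]
      congr 1
      rw [show -(r + 1) + 1 = -r by ring, neg_div_neg_eq]
    · refine (ae_restrict_iff' measurableSet_Ioi).2 (ae_of_all _ fun x hx => ?_)
      have : (0 : ℝ) < x := one_pos.trans hx
      simp only [Pi.zero_apply]
      positivity
  rw [← e, ← lintegral_indicator measurableSet_Ioi, ← lintegral_indicator measurableSet_Ioi,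
    ← lintegral_add_left_eq_self ((Set.Ioi 1).indicator _) (1 : ℝ)]
  refine lintegral_congr fun t => ?_
  simp [Set.indicator]

/-- Write `x/(x+y) = ∫ x e^{-t(x+y)} dt` over `t > 0` and swap by Tonelli. The gamma Laplace
transforms leave `∫ p (1+t)^{-(p+q+1)} dt`. -/
lemma lintegral_fst_div_add_gammaMeasure {p q : ℝ} (hp : 0 < p) (hq : 0 < q) :
    ∫⁻ z, ENNReal.ofReal (z.1 / (z.1 + z.2)) ∂(gammaMeasure p 1).prod (gammaMeasure q 1) =
      ENNReal.ofReal (p / (p + q)) := by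
  have := isProbabilityMeasure_gammaMeasure hp one_pos
  have := isProbabilityMeasure_gammaMeasure hq one_pos
  have key : ∀ x : ℝ, 0 < x → ∫⁻ y, ENNReal.ofReal (x / (x + y)) ∂gammaMeasure q 1 =
      ∫⁻ t in Set.Ioi (0 : ℝ), ENNReal.ofReal (x * Real.exp (-(t * x))) *
        ENNReal.ofReal ((1 + t) ^ (-q)) := by
    intro x hx
    have h1 : ∀ᵐ y ∂gammaMeasure q 1, ENNReal.ofReal (x / (x + y)) =
        ∫⁻ t in Set.Ioi (0 : ℝ), ENNReal.ofReal (x * Real.exp (-(t * x))) *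
          ENNReal.ofReal (Real.exp (-(t * y))) := by
      filter_upwards [ae_pos_gammaMeasure q] with y hy
      rw [div_eq_mul_one_div, ENNReal.ofReal_mul hx.le,
        ← lintegral_exp_neg_mul_Ioi (add_pos hx hy), ← lintegral_const_mul' _ _ ENNReal.ofReal_ne_top]
      refine lintegral_congr fun t => ?_
      rw [← ENNReal.ofReal_mul (by positivity), ← ENNReal.ofReal_mul (by positivity), mul_assoc,
        ← Real.exp_add]
      ring_nf
    rw [lintegral_congr_ae h1, lintegral_lintegral_swap (by fun_prop)]
    refine setLIntegral_congr_fun measurableSet_Ioi fun t ht => ?_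
    rw [lintegral_const_mul' _ _ ENNReal.ofReal_ne_top, lintegral_exp_neg_mul_gammaMeasure hq ht]
  rw [lintegral_prod _ (by fun_prop), lintegral_congr_ae
    ((ae_pos_gammaMeasure p).mono fun x hx => key x hx), lintegral_lintegral_swap (by fun_prop),
    div_eq_mul_one_div, ENNReal.ofReal_mul hp.le, ← lintegral_one_add_rpow_neg (add_pos hp hq),
    ← lintegral_const_mul' _ _ ENNReal.ofReal_ne_top]
  refine setLIntegral_congr_fun measurableSet_Ioi fun t ht => ?_
  have ht' : (0 : ℝ) < t := ht
  rw [lintegral_mul_const' _ _ ENNReal.ofReal_ne_top, lintegral_mul_exp_neg_mul_gammaMeasure hp ht,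
    ← ENNReal.ofReal_mul (by positivity), ← ENNReal.ofReal_mul (by positivity), mul_assoc,
    ← Real.rpow_add (by positivity)]
  ring_nf

lemma abs_sub_div_add_le_one {x y : ℝ} (hx : 0 < x) (hy : 0 < y) : |(y - x) / (y + x)| ≤ 1 := by
  rw [abs_div, abs_of_pos (add_pos hy hx), div_le_one (add_pos hy hx), abs_le]
  constructor <;> linarith

/-- The mean of `(Y - X)/(Y + X)` for independent gamma variables `X`, `Y` of shapes `p`, `q`. -/
lemma integral_sub_div_add_gammaMeasure {p q : ℝ} (hp : 0 < p) (hq : 0 < q) :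
    ∫ z, (z.2 - z.1) / (z.2 + z.1) ∂(gammaMeasure p 1).prod (gammaMeasure q 1) =
      (q - p) / (q + p) := by
  have := isProbabilityMeasure_gammaMeasure hp one_pos
  have := isProbabilityMeasure_gammaMeasure hq one_pos
  set μ := (gammaMeasure p 1).prod (gammaMeasure q 1)
  have hpos : ∀ᵐ z ∂μ, 0 < z.1 ∧ 0 < z.2 := by
    have h1 : ∀ᵐ z ∂μ, 0 < z.1 := Measure.quasiMeasurePreserving_fst.ae (ae_pos_gammaMeasure p)
    have h2 : ∀ᵐ z ∂μ, 0 < z.2 := Measure.quasiMeasurePreserving_snd.ae (ae_pos_gammaMeasure q)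
    exact h1.and h2
  have hm : Measurable fun z : ℝ × ℝ => z.1 / (z.1 + z.2) := by fun_prop
  have hI : ∫ z, z.1 / (z.1 + z.2) ∂μ = p / (p + q) := by
    rw [integral_eq_lintegral_of_nonneg_ae _ hm.aestronglyMeasurable,
      lintegral_fst_div_add_gammaMeasure hp hq, ENNReal.toReal_ofReal (by positivity)]
    filter_upwards [hpos] with z hz
    have := hz.1
    have := hz.2
    simp only [Pi.zero_apply]
    positivity
  have hint : Integrable (fun z : ℝ × ℝ => z.1 / (z.1 + z.2)) μ := by
    refine Integrable.of_integral_ne_zero ?_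
    rw [hI]
    positivity
  have he : ∀ᵐ z ∂μ, (z.2 - z.1) / (z.2 + z.1) = 1 - 2 * (z.1 / (z.1 + z.2)) := by
    filter_upwards [hpos] with z hz
    have : z.1 + z.2 ≠ 0 := (add_pos hz.1 hz.2).ne'
    rw [add_comm z.2]
    field_simp
    ring
  rw [integral_congr_ae he, integral_sub (integrable_const _) (hint.const_mul 2),
    integral_const_mul, hI]
  simp only [integral_const, probReal_univ, smul_eq_mul, mul_one]
  have : p + q ≠ 0 := (add_pos hp hq).ne'
  rw [add_comm q]
  field_simp
  ring

end Gamma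

/-! ### The mean of the Schur product at independent gamma variables. -/

section Expectation

open ProbabilityTheory

lemma integrable_gammaPDFReal {p : ℝ} (hp : 0 < p) : Integrable (gammaPDFReal p 1) := by
  refine ⟨(measurable_gammaPDFReal p 1).aestronglyMeasurable, ?_⟩
  rw [hasFiniteIntegral_iff_ofReal (ae_of_all _ (gammaPDFReal_nonneg hp one_pos))]
  exact (lintegral_gammaPDF_eq_one hp one_pos).trans_lt ENNReal.one_lt_top

lemma pi_gammaMeasure {ι : Type*} [Fintype ι] {p : ι → ℝ}
    (hp : ∀ i, 0 < p i) :
    Measure.pi (fun i => gammaMeasure (p i) 1) =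
      volume.withDensity fun x : ι → ℝ => ENNReal.ofReal (∏ i, gammaPDFReal (p i) 1 (x i)) := by
  have := fun i => isProbabilityMeasure_gammaMeasure (hp i) one_pos
  refine Measure.pi_eq fun s hs => ?_
  have hint : ∀ i, Integrable (gammaPDFReal (p i) 1) (volume.restrict (s i)) :=
    fun i => (integrable_gammaPDFReal (hp i)).restrict
  have hnn : ∀ i x, 0 ≤ gammaPDFReal (p i) 1 x := fun i => gammaPDFReal_nonneg (hp i) one_pos
  rw [withDensity_apply _ (MeasurableSet.univ_pi hs), volume_pi, Measure.restrict_pi_pi,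
    ← ofReal_integral_eq_lintegral_ofReal (Integrable.fintype_prod hint)
      (ae_of_all _ fun x => Finset.prod_nonneg fun i _ => hnn i _),
    integral_fintype_prod_eq_prod (fun i => gammaPDFReal (p i) 1),
    ENNReal.ofReal_prod_of_nonneg fun i _ => integral_nonneg (hnn i)]
  refine Finset.prod_congr rfl fun i _ => ?_
  rw [gammaMeasure, withDensity_apply _ (hs i),
    ofReal_integral_eq_lintegral_ofReal (hint i) (ae_of_all _ (hnn i))]
  rfl

/-- Each coincidence `x i = x j` defines a proper linear subspace, hence a null set. The expansions
of the Schur product need distinct variables. -/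
lemma ae_injective_volume {ι : Type*} [Fintype ι] :
    ∀ᵐ x : ι → ℝ, Function.Injective x := by
  have h : ∀ i j : ι, i ≠ j → ∀ᵐ x : ι → ℝ, x i ≠ x j := by
    intro i j hij
    classical
    let V : Submodule ℝ (ι → ℝ) := 
      LinearMap.ker ((LinearMap.proj i : (ι → ℝ) →ₗ[ℝ] ℝ) - LinearMap.proj j)
    have hV : V ≠ ⊤ := by
      intro hV
      have : Pi.single i (1 : ℝ) ∈ V := hV ▸ Submodule.mem_top
      simp [V, LinearMap.mem_ker, hij.symm] at this
    have := Measure.addHaar_submodule (volume : Measure (ι → ℝ)) V hV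
    rw [ae_iff]
    convert! this using 2
    ext x
    simp [V, LinearMap.mem_ker, sub_eq_zero]
  have h' : ∀ᵐ x : ι → ℝ, ∀ i j, i ≠ j → x i ≠ x j := by
    rw [ae_all_iff]
    intro i
    rw [ae_all_iff]
    intro j
    by_cases hij : i = j
    · simp [hij]
    · filter_upwards [h i j hij] with x hx _ using hx
  filter_upwards [h'] with x hx i j hij
  by_contra hne
  exact hx i j hne hij

lemma ae_pos_pi_gammaMeasure {ι : Type*} [Fintype ι] {p : ι → ℝ}
    (hp : ∀ i, 0 < p i) :
    ∀ᵐ x ∂Measure.pi (fun i => gammaMeasure (p i) 1), ∀ i, 0 < x i := by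
  have := fun i => isProbabilityMeasure_gammaMeasure (hp i) one_pos
  rw [ae_all_iff]
  exact fun i => Measure.tendsto_eval_ae_ae.eventually (ae_pos_gammaMeasure (p i))

lemma ae_injective_pi_gammaMeasure {ι : Type*} [Fintype ι] {p : ι → ℝ}
    (hp : ∀ i, 0 < p i) :
    ∀ᵐ x ∂Measure.pi (fun i => gammaMeasure (p i) 1), Function.Injective x := by
  rw [pi_gammaMeasure hp]
  exact (withDensity_absolutelyContinuous _ _).ae_le ae_injective_volume

lemma iIndepFun_eval_pi_gammaMeasure {ι : Type*} [Fintype ι] {p : ι → ℝ}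
    (hp : ∀ i, 0 < p i) :
    iIndepFun (fun i (x : ι → ℝ) => x i) (Measure.pi fun i => gammaMeasure (p i) 1) := by
  have := fun i => isProbabilityMeasure_gammaMeasure (hp i) one_pos
  exact iIndepFun_pi (X := fun _ => id) fun _ => aemeasurable_id

lemma integral_sub_div_add_pi {ι : Type*} [Fintype ι] {p : ι → ℝ} (hp : ∀ i, 0 < p i)
    {m k : ι} (hmk : m ≠ k) :
    ∫ x, (x k - x m) / (x k + x m) ∂Measure.pi (fun i => gammaMeasure (p i) 1) =
      (p k - p m) / (p k + p m) := by
  have := fun i => isProbabilityMeasure_gammaMeasure (hp i) one_pos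
  have hind := (iIndepFun_eval_pi_gammaMeasure hp).indepFun hmk
  rw [indepFun_iff_map_prod_eq_prod_map_map
    (measurable_pi_apply m).aemeasurable (measurable_pi_apply k).aemeasurable] at hind
  have hm := fun i => (measurePreserving_eval (fun i => gammaMeasure (p i) 1) i).map_eq
  have hmap : Measure.map (fun x : ι → ℝ => (x m, x k))
      (Measure.pi fun i => gammaMeasure (p i) 1) =
      (gammaMeasure (p m) 1).prod (gammaMeasure (p k) 1) := by
    rw [hind]
    exact congrArg₂ Measure.prod (hm m) (hm k)
  rw [← integral_sub_div_add_gammaMeasure (hp m) (hp k), ← hmap,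
    integral_map (by fun_prop) (Measurable.aestronglyMeasurable (by fun_prop))]

variable {ι : Type*} [LinearOrder ι]

lemma measurable_schurProd (s : Finset ι) : Measurable (schurProd s) := by
  unfold schurProd
  fun_prop

lemma abs_schurProd_le_one (s : Finset ι) {x : ι → ℝ} (hx : ∀ i, 0 < x i) :
    |schurProd s x| ≤ 1 := by
  rw [schurProd, Finset.abs_prod]
  refine Finset.prod_le_one (fun _ _ => abs_nonneg _) fun j _ => ?_
  rw [Finset.abs_prod]
  exact Finset.prod_le_one (fun _ _ => abs_nonneg _) fun k _ => abs_sub_div_add_le_one (hx j) (hx k)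

lemma schurProd_congr {s : Finset ι} {x y : ι → ℝ} (h : ∀ i ∈ s, x i = y i) :
    schurProd s x = schurProd s y := by
  refine Finset.prod_congr rfl fun j hj => Finset.prod_congr rfl fun k hk => ?_
  rw [h j hj, h k (Finset.mem_of_mem_filter k hk)]

variable [Fintype ι] {p : ι → ℝ}

lemma integrable_schurProd (hp : ∀ i, 0 < p i) (s : Finset ι) :
    Integrable (schurProd s) (Measure.pi fun i => gammaMeasure (p i) 1) := by
  have := fun i => isProbabilityMeasure_gammaMeasure (hp i) one_pos
  refine Integrable.of_bound (measurable_schurProd s).aestronglyMeasurable 1 ?_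
  filter_upwards [ae_pos_pi_gammaMeasure hp] with x hx using abs_schurProd_le_one s hx

lemma integrable_div_mul_schurProd (hp : ∀ i, 0 < p i) (s : Finset ι) (m k : ι) :
    Integrable (fun x => (x k - x m) / (x k + x m) * schurProd s x)
      (Measure.pi fun i => gammaMeasure (p i) 1) := by
  have := fun i => isProbabilityMeasure_gammaMeasure (hp i) one_pos
  have := measurable_schurProd s
  refine Integrable.of_bound (Measurable.aestronglyMeasurable (by fun_prop)) 1 ?_
  filter_upwards [ae_pos_pi_gammaMeasure hp] with x hx
  rw [Real.norm_eq_abs, abs_mul]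
  exact mul_le_one₀ (abs_sub_div_add_le_one (hx m) (hx k)) (abs_nonneg _) (abs_schurProd_le_one s hx)

lemma integral_div_mul_schurProd (hp : ∀ i, 0 < p i) (s : Finset ι) {m k : ι} (hmk : m ≠ k)
    (hm : m ∉ s) (hk : k ∉ s) :
    ∫ x, (x k - x m) / (x k + x m) * schurProd s x ∂Measure.pi (fun i => gammaMeasure (p i) 1) =
      (p k - p m) / (p k + p m) *
        ∫ x, schurProd s x ∂Measure.pi (fun i => gammaMeasure (p i) 1) := by
  have := fun i => isProbabilityMeasure_gammaMeasure (hp i) one_pos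
  have hdisj : Disjoint ({m, k} : Finset ι) s := by
    simp [Finset.disjoint_insert_left, hm, hk]
  have hind := (iIndepFun_eval_pi_gammaMeasure hp).indepFun_finset {m, k} s hdisj
    fun i => measurable_pi_apply i
  let φ : (({m, k} : Finset ι) → ℝ) → ℝ := fun v =>
    (v ⟨k, by simp⟩ - v ⟨m, by simp⟩) / (v ⟨k, by simp⟩ + v ⟨m, by simp⟩)
  -- The default 0 outside `s` is never seen, as `schurProd s` depends only on the coordinates in
  -- `s`.
  let ψ : (s → ℝ) → ℝ := fun v => schurProd s fun i => if h : i ∈ s then v ⟨i, h⟩ else 0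
  have hφ : Measurable φ := by fun_prop
  have hψ : Measurable ψ := by
    refine (measurable_schurProd s).comp (measurable_pi_lambda _ fun i => ?_)
    by_cases h : i ∈ s
    · simp only [h, dite_true]
      fun_prop
    · simp [h]
  have hψs : ∀ x : ι → ℝ, ψ (fun i : s => x i) = schurProd s x := fun x =>
    schurProd_congr fun i hi => by simp [hi]
  have h := hind.comp hφ hψ
  have h2 := h.integral_fun_mul_eq_mul_integral
    (Measurable.aestronglyMeasurable (by fun_prop)) (Measurable.aestronglyMeasurable (by fun_prop))
  simp only [Function.comp_def, hψs] at h2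
  rw [← integral_sub_div_add_pi hp hmk]
  exact h2

/-- The mean of `schurProd s` at independent gamma variables is `schurProd s` at their shapes. -/
theorem integral_schurProd (hp : ∀ i, 0 < p i) (hinj : Function.Injective p) (s : Finset ι) :
    ∫ x, schurProd s x ∂Measure.pi (fun i => gammaMeasure (p i) 1) = schurProd s p := by
  have := fun i => isProbabilityMeasure_gammaMeasure (hp i) one_pos
  -- Strong induction, since the even expansion removes two indices at once.
  induction s using Finset.strongInduction with
  | H s ih =>
  rcases Nat.even_or_odd s.card with he | ho
  · rcases s.eq_empty_or_nonempty with rfl | ⟨m, hm⟩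
    · simp [schurProd]
    have hodd : Odd (s.erase m).card := by
      rw [Finset.card_erase_of_mem hm]
      exact Nat.Even.sub_odd (Finset.card_pos.2 ⟨m, hm⟩) he odd_one
    have hae : ∀ᵐ x ∂Measure.pi (fun i => gammaMeasure (p i) 1), schurProd s x =
        eraseSign s m * ∑ k ∈ s.erase m, eraseSign (s.erase m) k *
          ((x k - x m) / (x k + x m) * schurProd ((s.erase m).erase k) x) := by
      filter_upwards [ae_pos_pi_gammaMeasure hp, ae_injective_pi_gammaMeasure hp] with x hx hxi
      exact schurProd_eq_sum_of_even s hm hodd (fun i _ => hx i) hxi.injOn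
    -- The same expansion is used at the random point and at the shapes, and the two are compared
    -- term by term.
    rw [integral_congr_ae hae, integral_const_mul, integral_finsetSum _ fun k _ =>
      (integrable_div_mul_schurProd hp _ m k).const_mul _,
      schurProd_eq_sum_of_even s hm hodd (fun i _ => hp i) hinj.injOn]
    congr 1
    refine Finset.sum_congr rfl fun k hk => ?_
    rw [integral_const_mul, integral_div_mul_schurProd hp _ (Finset.ne_of_mem_erase hk).symm
      (by simp) (by simp), ih]
    exact (Finset.erase_subset _ _).trans_ssubset (Finset.erase_ssubset hm)
  · have hae : ∀ᵐ x ∂Measure.pi (fun i => gammaMeasure (p i) 1), schurProd s x =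
        ∑ k ∈ s, eraseSign s k * schurProd (s.erase k) x := by
      filter_upwards [ae_pos_pi_gammaMeasure hp, ae_injective_pi_gammaMeasure hp] with x hx hxi
      exact schurProd_eq_sum_of_odd s ho (fun i _ => hx i) hxi.injOn
    rw [integral_congr_ae hae, integral_finsetSum _ fun k _ =>
      (integrable_schurProd hp _).const_mul _,
      schurProd_eq_sum_of_odd s ho (fun i _ => hp i) hinj.injOn]
    refine Finset.sum_congr rfl fun k hk => ?_
    rw [integral_const_mul, ih _ (Finset.erase_ssubset hk)]

end Expectation

/-! ### From gamma expectations to Lebesgue integrals on the orthant. -/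

section Orthant

open ProbabilityTheory

lemma measurableSet_positiveOrthant (N : ℕ) : MeasurableSet (positiveOrthant N) := by
  have : positiveOrthant N = ⋂ j, {x : Fin N → ℝ | 0 < x j} := by
    ext x
    simp [positiveOrthant]
  rw [this]
  exact MeasurableSet.iInter fun j => measurableSet_lt measurable_const (measurable_pi_apply j)

lemma toReal_ofReal_prod_gammaPDFReal {N : ℕ} {p : Fin N → ℝ} (hp : ∀ i, 0 < p i)
    {x : Fin N → ℝ} (hx : x ∈ positiveOrthant N) :
    (ENNReal.ofReal (∏ i, gammaPDFReal (p i) 1 (x i))).toReal =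
      (∏ i, Real.Gamma (p i))⁻¹ * ∏ i, (x i ^ (p i - 1) * Real.exp (-x i)) := by
  rw [ENNReal.toReal_ofReal (Finset.prod_nonneg fun i _ => gammaPDFReal_nonneg (hp i) one_pos _),
    ← Finset.prod_inv_distrib, ← Finset.prod_mul_distrib]
  refine Finset.prod_congr rfl fun i _ => ?_
  rw [gammaPDFReal, if_pos (hx i).le]
  simp [mul_assoc]

lemma pi_gammaMeasure_eq_withDensity_restrict {N : ℕ} {p : Fin N → ℝ} (hp : ∀ i, 0 < p i) :
    Measure.pi (fun i => gammaMeasure (p i) 1) =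
      (volume.restrict (positiveOrthant N)).withDensity
        fun x => ENNReal.ofReal (∏ i, gammaPDFReal (p i) 1 (x i)) := by
  rw [← restrict_withDensity (measurableSet_positiveOrthant N), ← pi_gammaMeasure hp]
  exact (Measure.restrict_eq_self_of_ae_mem (ae_pos_pi_gammaMeasure hp)).symm

lemma measurable_ofReal_prod_gammaPDFReal {N : ℕ} (p : Fin N → ℝ) :
    Measurable fun x : Fin N → ℝ => ENNReal.ofReal (∏ i, gammaPDFReal (p i) 1 (x i)) := by
  fun_prop

lemma integrableOn_schurProd_mul {N : ℕ} {p : Fin N → ℝ} (hp : ∀ i, 0 < p i) :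
    IntegrableOn (fun x => schurProd Finset.univ x * ∏ i, (x i ^ (p i - 1) * Real.exp (-x i)))
      (positiveOrthant N) := by
  have h := integrable_schurProd hp Finset.univ
  rw [pi_gammaMeasure_eq_withDensity_restrict hp, integrable_withDensity_iff_integrable_smul'
    (measurable_ofReal_prod_gammaPDFReal p) (by simp)] at h
  refine IntegrableOn.congr_fun (h.const_mul (∏ i, Real.Gamma (p i))) (fun x hx => ?_)
    (measurableSet_positiveOrthant N)
  have hG : ∏ i, Real.Gamma (p i) ≠ 0 :=
    Finset.prod_ne_zero_iff.2 fun i _ => (Real.Gamma_pos_of_pos (hp i)).ne'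
  simp only [toReal_ofReal_prod_gammaPDFReal hp hx, smul_eq_mul]
  field_simp

lemma setIntegral_schurProd_mul {N : ℕ} {p : Fin N → ℝ} (hp : ∀ i, 0 < p i)
    (hinj : Function.Injective p) :
    ∫ x in positiveOrthant N, schurProd Finset.univ x * ∏ i, (x i ^ (p i - 1) * Real.exp (-x i)) =
      (∏ i, Real.Gamma (p i)) * schurProd Finset.univ p := by
  rw [← integral_schurProd hp hinj, pi_gammaMeasure_eq_withDensity_restrict hp,
    integral_withDensity_eq_integral_toReal_smul (measurable_ofReal_prod_gammaPDFReal p) (by simp),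
    ← integral_const_mul]
  refine setIntegral_congr_fun (measurableSet_positiveOrthant N) fun x hx => ?_
  have hG : ∏ i, Real.Gamma (p i) ≠ 0 :=
    Finset.prod_ne_zero_iff.2 fun i _ => (Real.Gamma_pos_of_pos (hp i)).ne'
  simp only [toReal_ofReal_prod_gammaPDFReal hp hx, smul_eq_mul]
  field_simp

end Orthant

/-! ### Antisymmetry of the Schur product and expansion of the density. -/

section Antisymmetry

lemma schurProd_univ {N : ℕ} (x : Fin N → ℝ) :
    schurProd Finset.univ x = ∏ j, ∏ k ∈ Finset.Ioi j, (x k - x j) / (x k + x j) := by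
  refine Finset.prod_congr rfl fun j _ => Finset.prod_congr ?_ fun _ _ => rfl
  ext k
  simp

/-- Makes antisymmetry visible: a permutation multiplies the ratio by `sign ^ 2 / sign`. Division by
zero returning 0 makes it hold for every `x`. -/
lemma schurProd_univ_eq_det {N : ℕ} (x : Fin N → ℝ) :
    schurProd Finset.univ x =
      (Matrix.vandermonde x).det ^ 2 / (Matrix.vandermonde fun i => x i ^ 2).det := by
  rw [schurProd_univ, Matrix.det_vandermonde, Matrix.det_vandermonde]
  simp only [← Finset.prod_pow, ← Finset.prod_div_distrib]
  refine Finset.prod_congr rfl fun j _ => Finset.prod_congr rfl fun k _ => ?_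
  rw [sq_sub_sq, sq, mul_comm (x k + x j)]
  rcases eq_or_ne (x k - x j) 0 with h | h
  · simp [h]
  · rw [mul_div_mul_left _ _ h]

lemma schurProd_comp_perm {N : ℕ} (x : Fin N → ℝ) (σ : Equiv.Perm (Fin N)) :
    schurProd Finset.univ (x ∘ σ) = Equiv.Perm.sign σ * schurProd Finset.univ x := by
  have h : ∀ y : Fin N → ℝ, (Matrix.vandermonde (y ∘ σ)).det =
      Equiv.Perm.sign σ * (Matrix.vandermonde y).det := fun y =>
    Matrix.det_permute σ (Matrix.vandermonde y)
  rw [schurProd_univ_eq_det, schurProd_univ_eq_det, h x]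
  have h2 := h fun i => x i ^ 2
  simp only [Function.comp_def] at h2 ⊢
  rw [h2]
  rcases Int.units_eq_one_or (Equiv.Perm.sign σ) with hs | hs <;> simp [hs, div_neg]

/-- Leibniz expansion of the Vandermonde determinant in `x i ^ θ`, transposed so that `σ` acts on
the exponents and not on the variables. -/
lemma buresDensity_eq_sum {N : ℕ} (a θ : ℝ) {x : Fin N → ℝ} (hx : x ∈ positiveOrthant N) :
    buresDensity N a θ x = ∑ σ : Equiv.Perm (Fin N), (Equiv.Perm.sign σ : ℝ) *
      (schurProd Finset.univ x *
        ∏ i, (x i ^ ((a + 1 + θ * ((σ i : Fin N) : ℝ)) - 1) * Real.exp (-x i))) := by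
  rw [buresDensity]
  simp only [Finset.prod_mul_distrib]
  rw [← schurProd_univ, ← Matrix.det_vandermonde fun i => x i ^ θ, ← Matrix.det_transpose,
    Matrix.det_apply', Finset.mul_sum, Finset.sum_mul]
  refine Finset.sum_congr rfl fun σ _ => ?_
  have h : ∏ i, x i ^ ((a + 1 + θ * ((σ i : Fin N) : ℝ)) - 1) =
      (∏ i, (x i ^ θ) ^ ((σ i : Fin N) : ℕ)) * ∏ i, x i ^ a := by
    rw [← Finset.prod_mul_distrib]
    refine Finset.prod_congr rfl fun i _ => ?_
    rw [← Real.rpow_mul_natCast (hx i).le, ← Real.rpow_add (hx i)]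
    congr 1
    ring
  simp only [h, Matrix.transpose_apply, Matrix.vandermonde_apply]
  ring

end Antisymmetry

/-! ### Evaluation in closed form. -/

section Evaluation

lemma buresParam_pos {a θ : ℝ} (ha : -1 < a) (hθ : 0 < θ) (n : ℕ) : 0 < a + 1 + θ * n := by
  have : 0 ≤ θ * n := by positivity
  linarith

lemma buresParam_injective (N : ℕ) (a : ℝ) {θ : ℝ} (hθ : 0 < θ) :
    Function.Injective fun i : Fin N => a + 1 + θ * (i : ℝ) := by
  intro i j hij
  have : (i : ℝ) = j := mul_left_cancel₀ hθ.ne' (add_left_cancel hij)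
  exact Fin.ext (by exact_mod_cast this)

lemma integrableOn_buresDensity (N : ℕ) {a θ : ℝ} (ha : -1 < a) (hθ : 0 < θ) :
    IntegrableOn (buresDensity N a θ) (positiveOrthant N) := by
  refine IntegrableOn.congr_fun ?_ (fun x hx => (buresDensity_eq_sum a θ hx).symm)
    (measurableSet_positiveOrthant N)
  exact integrable_finsetSum _ fun σ _ => (integrableOn_schurProd_mul
    (p := fun i => a + 1 + θ * ((σ i : Fin N) : ℝ)) fun i => buresParam_pos ha hθ _).const_mul _

/-- The partition function as a product of gamma values and a Schur product of the exponents. -/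
lemma buresPartition_eq_schurProd (N : ℕ) {a θ : ℝ} (ha : -1 < a) (hθ : 0 < θ) :
    buresPartition N a θ = (∏ i : Fin N, Real.Gamma (a + 1 + θ * (i : ℝ))) *
      schurProd Finset.univ fun i : Fin N => a + 1 + θ * (i : ℝ) := by
  set p : Fin N → ℝ := fun i => a + 1 + θ * (i : ℝ)
  have hp : ∀ i, 0 < p i := fun i => buresParam_pos ha hθ _
  have hinj : Function.Injective p := buresParam_injective N a hθ
  have hterm : ∀ σ : Equiv.Perm (Fin N),
      ∫ x in positiveOrthant N, (Equiv.Perm.sign σ : ℝ) * (schurProd Finset.univ x *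
        ∏ i, (x i ^ (p (σ i) - 1) * Real.exp (-x i))) =
      (∏ i, Real.Gamma (p i)) * schurProd Finset.univ p := by
    intro σ
    -- The permuted shapes yield a second `sign σ`, and the two signs multiply to 1.
    have h := setIntegral_schurProd_mul (p := p ∘ σ) (fun i => hp _) (hinj.comp σ.injective)
    rw [schurProd_comp_perm] at h
    simp only [Function.comp_apply] at h
    rw [integral_const_mul, h, Equiv.prod_comp σ fun i => Real.Gamma (p i)]
    rcases Int.units_eq_one_or (Equiv.Perm.sign σ) with hs | hs <;> simp [hs]
  have hsum : ∀ x ∈ positiveOrthant N, buresDensity N a θ x = ∑ σ : Equiv.Perm (Fin N),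
      (Equiv.Perm.sign σ : ℝ) * (schurProd Finset.univ x *
        ∏ i, (x i ^ (p (σ i) - 1) * Real.exp (-x i))) := fun x hx => buresDensity_eq_sum a θ hx
  rw [buresPartition, setIntegral_congr_fun (measurableSet_positiveOrthant N) hsum,
    integral_finsetSum _ fun σ _ => (integrableOn_schurProd_mul
      (p := fun i => p (σ i)) fun i => hp _).const_mul _,
    Finset.sum_congr rfl fun σ _ => hterm σ, Finset.sum_const, Finset.card_univ,
    Fintype.card_perm, Fintype.card_fin, nsmul_eq_mul, ← mul_assoc, one_div,
    inv_mul_cancel₀ (by positivity), one_mul]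

lemma prod_range_sub_eq_Gamma (n : ℕ) :
    ∏ j ∈ Finset.range n, ((n : ℝ) - j) = Real.Gamma (n + 1) := by
  rw [Real.Gamma_nat_eq_factorial]
  induction n with
  | zero => simp
  | succ n ih =>
    rw [Finset.prod_range_succ', Nat.factorial_succ]
    push_cast
    rw [← ih, sub_zero, mul_comm]
    simp only [add_sub_add_right_eq_sub]

lemma prod_range_add_eq_Gamma_div {z : ℝ} (hz : 0 < z) (n : ℕ) :
    ∏ j ∈ Finset.range n, (z + j) = Real.Gamma (z + n) / Real.Gamma z := by
  have hG := (Real.Gamma_pos_of_pos hz).ne'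
  induction n with
  | zero => simp [hG]
  | succ n ih =>
    have : z + n ≠ 0 := by positivity
    rw [Finset.prod_range_succ, ih]
    push_cast
    rw [← add_assoc, Real.Gamma_add_one this]
    ring

lemma schurProd_range_succ (q : ℕ → ℝ) (n : ℕ) :
    schurProd (Finset.range (n + 1)) q =
      schurProd (Finset.range n) q * ∏ j ∈ Finset.range n, (q n - q j) / (q n + q j) := by
  simp only [schurProd, Finset.prod_filter]
  have h : ∏ k ∈ Finset.range (n + 1), (if n < k then (q k - q n) / (q k + q n) else 1) = 1 :=
    Finset.prod_eq_one fun k hk => if_neg (by have := Finset.mem_range.1 hk; omega)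
  rw [Finset.prod_range_succ, h, mul_one, ← Finset.prod_mul_distrib]
  refine Finset.prod_congr rfl fun j hj => ?_
  rw [Finset.prod_range_succ, if_pos (Finset.mem_range.1 hj)]

lemma schurProd_fin_eq_range (q : ℕ → ℝ) (N : ℕ) :
    schurProd Finset.univ (fun i : Fin N => q i) = schurProd (Finset.range N) q := by
  simp only [schurProd, Finset.prod_filter]
  rw [← Fin.prod_univ_eq_prod_range]
  refine Finset.prod_congr rfl fun j _ => ?_
  rw [← Fin.prod_univ_eq_prod_range]
  rfl

/-- The scale `θ` cancels in each ratio. The factors of a new index `n` are `(n - j)/(2β + n + 2 +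
j)`, so their product is a ratio of gamma values. -/
lemma schurProd_range_arith {θ β : ℝ} (hθ : 0 < θ) (hβ : 0 < β + 1) (N : ℕ) :
    schurProd (Finset.range N) (fun j : ℕ => θ * (β + j + 1)) =
      ∏ j ∈ Finset.range N, (Real.Gamma ((j : ℝ) + 1) * Real.Gamma (2 * β + (j : ℝ) + 2) /
        Real.Gamma (2 * (β + (j : ℝ) + 1))) := by
  induction N with
  | zero => simp [schurProd]
  | succ n ih =>
    rw [schurProd_range_succ, ih, Finset.prod_range_succ]
    congr 1
    have hz : 0 < 2 * β + n + 2 := by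
      have : (0 : ℝ) ≤ n := n.cast_nonneg
      linarith
    have h : ∀ j ∈ Finset.range n, (θ * (β + n + 1) - θ * (β + j + 1)) /
        (θ * (β + n + 1) + θ * (β + j + 1)) = ((n : ℝ) - j) / (2 * β + n + 2 + j) := by
      intro j _
      rw [← mul_sub, ← mul_add, mul_div_mul_left _ _ hθ.ne']
      congr 1 <;> ring
    rw [Finset.prod_congr rfl h, Finset.prod_div_distrib, prod_range_sub_eq_Gamma,
      prod_range_add_eq_Gamma_div hz, div_div_eq_mul_div]
    congr 2
    ring

/-- By `Γ(z+1) = zΓ(z)` the radicand is `θ` times a perfect square. -/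
lemma sqrt_Gamma_ratio {θ b : ℝ} (hθ : 0 < θ) (hb : 0 < b) :
    Real.sqrt (Real.Gamma (2 * θ * b) * Real.Gamma (2 * θ * b + 1) /
      (Real.Gamma (2 * b) * Real.Gamma (2 * b + 1))) =
      Real.sqrt θ * (Real.Gamma (2 * θ * b) / Real.Gamma (2 * b)) := by
  have h1 : 0 < Real.Gamma (2 * θ * b) := Real.Gamma_pos_of_pos (by positivity)
  have h2 : 0 < Real.Gamma (2 * b) := Real.Gamma_pos_of_pos (by positivity)
  rw [Real.Gamma_add_one (by positivity), Real.Gamma_add_one (by positivity)]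
  have : Real.Gamma (2 * θ * b) * (2 * θ * b * Real.Gamma (2 * θ * b)) /
      (Real.Gamma (2 * b) * (2 * b * Real.Gamma (2 * b))) =
      θ * (Real.Gamma (2 * θ * b) / Real.Gamma (2 * b)) ^ 2 := by
    field_simp
  rw [this, Real.sqrt_mul hθ.le, Real.sqrt_sq (by positivity)]

/-- Legendre duplication; it produces the powers of 2 and of `π` in the final formula. -/
lemma Gamma_two_mul_div {s : ℝ} (hs : 0 < s) :
    Real.Gamma (2 * s) / Real.Gamma (s + 1 / 2) =
      Real.Gamma s * (2 : ℝ) ^ (2 * s - 1) / Real.sqrt Real.pi := by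
  have h := Real.Gamma_mul_Gamma_add_half s
  have h1 : 0 < Real.Gamma (s + 1 / 2) := Real.Gamma_pos_of_pos (by positivity)
  have hpi : 0 < Real.sqrt Real.pi := Real.sqrt_pos.2 Real.pi_pos
  have h2 : (2 : ℝ) ^ (1 - 2 * s) * (2 : ℝ) ^ (2 * s - 1) = 1 := by
    rw [← Real.rpow_add two_pos]
    simp
  rw [div_eq_div_iff h1.ne' hpi.ne']
  linear_combination (-(2 : ℝ) ^ (2 * s - 1)) * h - Real.Gamma (2 * s) * Real.sqrt Real.pi * h2

lemma prod_two_rpow (a θ : ℝ) (N : ℕ) :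
    ∏ j ∈ Finset.range N, (2 : ℝ) ^ (2 * (a + 1 + θ * (j : ℝ)) - 1) =
      (2 : ℝ) ^ (θ * (N : ℝ) ^ 2 + 2 * a * (N : ℝ) - (θ - 1) * (N : ℝ)) := by
  induction N with
  | zero => simp
  | succ n ih =>
    rw [Finset.prod_range_succ, ih, ← Real.rpow_add two_pos]
    congr 1
    push_cast
    ring

end Evaluation

theorem mainTheorem10 (N : ℕ) (a θ β : ℝ) (ha : -1 < a) (hθ : 0 < θ)
    (hβ : β = (a + 1) / θ - 1) :
    IntegrableOn (buresDensity N a θ) (positiveOrthant N) volume ∧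
    buresPartition N a θ =
      Real.pi ^ ((N : ℝ) / 2) /
          (θ ^ ((N : ℝ) / 2) *
            (2 : ℝ) ^ (θ * (N : ℝ) ^ 2 + 2 * a * (N : ℝ) - (θ - 1) * (N : ℝ))) *
        ∏ j ∈ Finset.range N,
          (Real.Gamma ((j : ℝ) + 1) * Real.Gamma (2 * β + (j : ℝ) + 2) /
              Real.Gamma (θ * ((j : ℝ) + β + 1) + 1 / 2) *
            Real.sqrt
              (Real.Gamma (2 * θ * (β + (j : ℝ) + 1)) *
                  Real.Gamma (2 * θ * (β + (j : ℝ) + 1) + 1) /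
                (Real.Gamma (2 * (β + (j : ℝ) + 1)) *
                  Real.Gamma (2 * (β + (j : ℝ) + 1) + 1)))) := by
  refine ⟨integrableOn_buresDensity N ha hθ, ?_⟩
  have hβ1 : 0 < β + 1 := by
    rw [hβ, sub_add_cancel]
    exact div_pos (by linarith) hθ
  have hparam : ∀ j : ℕ, a + 1 + θ * (j : ℝ) = θ * (β + j + 1) := by
    intro j
    rw [hβ]
    field_simp
    ring
  have hsθ : 0 < Real.sqrt θ := Real.sqrt_pos.2 hθ
  have hsπ : 0 < Real.sqrt Real.pi := Real.sqrt_pos.2 Real.pi_pos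
  have hpow : ∀ c : ℝ, 0 ≤ c → c ^ ((N : ℝ) / 2) = Real.sqrt c ^ N := fun c hc => by
    rw [Real.sqrt_eq_rpow, ← Real.rpow_mul_natCast hc]
    congr 1
    ring
  -- `√θ` comes from the square root, and `1/√π` and the power of 2 from duplication at `s = θ(β + j
  -- + 1)`. These constants multiply up to the reciprocal of the prefactor.
  have hfactor : ∀ j ∈ Finset.range N,
      Real.Gamma ((j : ℝ) + 1) * Real.Gamma (2 * β + (j : ℝ) + 2) /
          Real.Gamma (θ * ((j : ℝ) + β + 1) + 1 / 2) *
        Real.sqrt (Real.Gamma (2 * θ * (β + (j : ℝ) + 1)) *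
            Real.Gamma (2 * θ * (β + (j : ℝ) + 1) + 1) /
          (Real.Gamma (2 * (β + (j : ℝ) + 1)) * Real.Gamma (2 * (β + (j : ℝ) + 1) + 1))) =
      (Real.sqrt θ / Real.sqrt Real.pi * (2 : ℝ) ^ (2 * (a + 1 + θ * (j : ℝ)) - 1)) *
        (Real.Gamma (a + 1 + θ * (j : ℝ)) * (Real.Gamma ((j : ℝ) + 1) *
          Real.Gamma (2 * β + (j : ℝ) + 2) / Real.Gamma (2 * (β + (j : ℝ) + 1)))) := by
    intro j _
    have hb : 0 < β + j + 1 := by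
      have : (0 : ℝ) ≤ j := j.cast_nonneg
      linarith
    have hdup := Gamma_two_mul_div (mul_pos hθ hb)
    rw [sqrt_Gamma_ratio hθ hb, hparam, add_comm (j : ℝ) β, mul_assoc 2 θ]
    linear_combination (Real.Gamma ((j : ℝ) + 1) * Real.Gamma (2 * β + (j : ℝ) + 2) *
      Real.sqrt θ / Real.Gamma (2 * (β + (j : ℝ) + 1))) * hdup
  rw [Finset.prod_congr rfl hfactor, Finset.prod_mul_distrib, Finset.prod_mul_distrib,
    Finset.prod_const, Finset.card_range, prod_two_rpow, hpow _ hθ.le, hpow _ Real.pi_pos.le,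
    buresPartition_eq_schurProd N ha hθ, schurProd_fin_eq_range fun j : ℕ => a + 1 + θ * (j : ℝ),
    Fin.prod_univ_eq_prod_range fun j : ℕ => Real.Gamma (a + 1 + θ * (j : ℝ)), Finset.prod_mul_distrib,
    funext hparam, schurProd_range_arith hθ hβ1, div_pow]
  have h2 : (0 : ℝ) < (2 : ℝ) ^ (θ * (N : ℝ) ^ 2 + 2 * a * (N : ℝ) - (θ - 1) * (N : ℝ)) :=
    Real.rpow_pos_of_pos two_pos _
  field_simp
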